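/- **Proposition 20 (time evolution, Galilean geometry).** Fix, once for all systems, a constant $\hbar>0$ (its value depends only on the choice of units). *Setting.* Let $H$ be a complex Hilbert space. A model of a system consists of: a set $M$ of configurations; a complex Banach space $E$ (continuous variables) with an injective linear map $\Upsilon:E\to H$ of dense range (linear chart), $E$ carrying the hermitian product $\langle x,y\rangle_E=\langle\Upsilon x,\Upsilon y\rangle_H$; a discrete variable with $d\ge 1$ values, represented by the canonical basis $(e_k)$ of $\mathbb C^d$, and by an orthonormal family $(\upsilon_k)_{k=1}^d$ of $H$, through the linear map $\Upsilon_d:\mathbb C^d\to H$, $\Upsilon_d(e_k)=\upsilon_k$; and, for each $k$, a nonempty open set $E_k\subset E$ of possible values of the continuous variables. Observers are labelled by the displacement $a\in\mathbb R$ of their clocks (universal time); in the configuration $m\in M$ the observer $a$ finds $X_a(m)\in E$ and $D_a(m)\in\mathbb C^d$, and $(D_0,X_0)$ takes exactly the values $(e_k,x)$ with $x\in E_k$. There are maps $U(\theta):E\to E$, $U_d(\theta):\mathbb C^d\to\mathbb C^d$ ($\theta\in\mathbb R$), which preserve the hermitian products (they are not assumed linear or bijective), such that $X_{a+\theta}(m)=U(\theta)(X_a(m))$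 and $D_{a+\theta}(m)=U_d(\theta)(D_a(m))$ for all $a,\theta,m$. The evolution of the system in the configuration $m$ is the map $t\mapsto(\psi_d(t),\psi(t))=(\Upsilon_d D_t(m),\Upsilon X_t(m))$ from $\mathbb R$ to the affine Hilbert space $\widehat H$, whose points are the couples of vectors of $H$. *Conclusion.* There are one parameter groups $\widehat U_d,\widehat U$ of unitary operators on $H$, the same for all configurations, with $\widehat U_d(t)\Upsilon_d=\Upsilon_dU_d(t)$ and $\widehat U(t)\Upsilon=\Upsilon U(t)$, such that for every evolution $$\psi_d(t)=\widehat U_d(t)\psi_d(0),\qquad \psi(t)=\widehat U(t)\psi(0).$$ If a bounded operator $\widehat Y$ on $H$ represents an observable $Y:E\to E$, i.e. $\widehat Y\Upsilon=\Upsilon Y$, then $\widehat Y(t)=\widehat U(t)\widehat Y\widehat U(t)^*$ represents it for the observer $t$: $\widehat Y(t)\Upsilon U(t)=\Upsilon U(t)Y$; and similarly for the discrete variables. Moreover, if for every configuration the evolution $t\mapsto\psi(t)$ of the continuous variables is continuous, there is a self-adjoint (possibly unbounded) operator $A$ on $H$ (the Hamiltonian) such that: 1. $A$ is the generator of $\widehat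 U$: $\psi\in\operatorname{dom}A$ iff $t\mapsto\widehat U(t)\psi$ is differentiable at $0$, and then $i\hbar\frac{d}{dt}\widehat U(t)\psi|_{t=0}=A\psi$; and $$\widehat U(t)=\exp\left(\tfrac{1}{i\hbar}tA\right)\quad\text{for all }t\in\mathbb R,$$ where, for imaginary $c$, $\exp(cA)$ is the strong limit of the power series $\exp(cA_n)$ of the bounded operators $A_n=n^2A(A^2+n^2)^{-1}$; 2. $\widehat U(t)$ maps $\operatorname{dom}A$ into itself and commutes with $A$ there; 3. (Schrödinger equation) for $\psi(0)\in\operatorname{dom}A$, $\psi(t)=\widehat U(t)\psi(0)$ stays in $\operatorname{dom}A$ and $i\hbar\frac{d\psi}{dt}=A\psi(t)$ for all $t$; and every evolution satisfies $i\hbar\frac{d}{dt}\langle\varphi,\psi(t)\rangle=\langle A\varphi,\psi(t)\rangle$ for all $\varphi\in\operatorname{dom}A$; 4. (Heisenberg equation) for every bounded operator $\widehat Y$ on $H$, with $\widehat Y(t)=\widehat U(t)\widehat Y\widehat U(t)^*$: $i\hbar\frac{d}{dt}\widehat Y(t)\psi=[A,\widehat Y(t)]\psi$ whenever $\psi\in\operatorname{dom}A$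 and $\widehat Y(t)\psi\in\operatorname{dom}A$, and, for all $\varphi,\psi\in\operatorname{dom}A$, $i\hbar\frac{d}{dt}\langle\varphi,\widehat Y(t)\psi\rangle=\langle A\varphi,\widehat Y(t)\psi\rangle-\langle\varphi,\widehat Y(t)A\psi\rangle$. -/

import Mathlib

open Filter Topology

noncomputable section

/-- The points of the affine Hilbert space `Ĥ` modelled on `H`: couples `(ψ_d, ψ)` of vectors of
`H`, the first one representing the discrete variables, the second one the continuous variables.
The points with a fixed first coordinate form an affine hyperplane with direction `H`. -/
abbrev AffineHilbert (H : Type*) := H × H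

/-- A model of a physical system observed along the universal time of Galilean geometry.

* `M` is the set of configurations (followed over the whole evolution) of the system;
* `E` is the Banach space of the continuous variables; the discrete variable takes `d` values,
  represented by the vectors of the canonical basis of `ℂ^d`;
* an observer is determined by its clock: the observer `a : ℝ` uses the time `t' = t + a`. In the
  configuration `m` it finds the values `X a m` and `D a m` (this is also the value at the time `a`
  for the observer `0`). -/
structure GalileanModel (M E H : Type*) [NormedAddCommGroup E] [NormedSpace ℂ E]
    [NormedAddCommGroup H] [InnerProductSpace ℂ H] (d : ℕ) where
  /-- The linear chart `Υ`, which represents the continuous variables in `H`. The hermitian product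
  on `E` is `⟨x, y⟩_E = ⟨Υ x, Υ y⟩`. -/
  chart : E →ₗ[ℂ] H
  chart_injective : Function.Injective chart
  chart_denseRange : DenseRange chart
  /-- The vectors `υ_1, …, υ_d` of `H` which represent the values of the discrete variable. -/
  label : Fin d → H
  label_orthonormal : Orthonormal ℂ label
  /-- The set of the values of the continuous variables for each value of the discrete one. -/
  states : Fin d → Set E
  states_isOpen : ∀ k, IsOpen (states k)
  states_nonempty : ∀ k, (states k).Nonempty
  /-- The value of the continuous variables found by each observer. -/
  X : ℝ → M → E
  /-- The value of the discrete variable found by each observer. -/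
  D : ℝ → M → EuclideanSpace ℂ (Fin d)
  /-- The set of values found by the reference observer. -/
  range_reference : Set.range (fun m => (D 0 m, X 0 m)) =
    {p | ∃ k, p.1 = EuclideanSpace.single k 1 ∧ p.2 ∈ states k}
  /-- The law of conversion of the continuous variables between two observers. It depends only on
  the displacement of their clocks, and it is not assumed to be linear or bijective. -/
  conv : ℝ → E → E
  X_add : ∀ a θ m, X (a + θ) m = conv θ (X a m)
  inner_conv : ∀ θ x y, inner ℂ (chart (conv θ x)) (chart (conv θ y)) = inner ℂ (chart x) (chart y)
  /-- The law of conversion of the discrete variable. -/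
  convD : ℝ → EuclideanSpace ℂ (Fin d) → EuclideanSpace ℂ (Fin d)
  D_add : ∀ a θ m, D (a + θ) m = convD θ (D a m)
  inner_convD : ∀ θ v w, inner ℂ (convD θ v) (convD θ w) = inner ℂ v w

namespace GalileanModel

variable {M E H : Type*} [NormedAddCommGroup E] [NormedSpace ℂ E]
  [NormedAddCommGroup H] [InnerProductSpace ℂ H] {d : ℕ}

/-- The representation in `H` of the discrete variable: it maps the `k`-th vector of the canonical
basis of `ℂ^d` to `υ_k`. -/
def chartD (S : GalileanModel M E H d) (v : EuclideanSpace ℂ (Fin d)) : H :=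
  ∑ k, v k • S.label k

/-- The evolution `t ↦ (ψ_d(t), ψ(t))` of the system in the configuration `m`. -/
def evolution (S : GalileanModel M E H d) (m : M) (t : ℝ) : AffineHilbert H :=
  (S.chartD (S.D t m), S.chart (S.X t m))

end GalileanModel

/-- `U` is a one parameter group of unitary operators of `H` (no continuity is assumed). -/
structure IsUnitaryGroup {H : Type*} [NormedAddCommGroup H] [InnerProductSpace ℂ H]
    [CompleteSpace H] (U : ℝ → H →L[ℂ] H) : Prop where
  unitary : ∀ t, U t ∈ unitary (H →L[ℂ] H)
  zero : U 0 = 1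
  add : ∀ s t, U (s + t) = U s * U t

/-- `R = (A - z)⁻¹`: the bounded operator `R` is the resolvent at `z` of the operator `A`, which is
defined on a subspace of `H`. -/
def IsResolvent {H : Type*} [NormedAddCommGroup H] [InnerProductSpace ℂ H]
    (A : H →ₗ.[ℂ] H) (z : ℂ) (R : H →L[ℂ] H) : Prop :=
  (∀ ψ, ∃ h : R ψ ∈ A.domain, A ⟨R ψ, h⟩ - z • R ψ = ψ) ∧
    ∀ φ : A.domain, R (A φ - z • (φ : H)) = φ

/-- For `A` self-adjoint and `n > 0`, `B` is the bounded self-adjoint operator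
`n² A (A² + n²)⁻¹ = (n² / 2) ((A - i n)⁻¹ + (A + i n)⁻¹)`. It converges to `A` on the domain of `A`
when `n` goes to infinity. -/
def IsBoundedApprox {H : Type*} [NormedAddCommGroup H] [InnerProductSpace ℂ H]
    (A : H →ₗ.[ℂ] H) (n : ℝ) (B : H →L[ℂ] H) : Prop :=
  ∃ R₁ R₂ : H →L[ℂ] H, IsResolvent A (Complex.I * n) R₁ ∧ IsResolvent A (-(Complex.I * n)) R₂ ∧
    B = ((n : ℂ) ^ 2 / 2) • (R₁ + R₂)

/-- `V = exp (c A)`, for a self-adjoint, possibly unbounded, operator `A` and an imaginary number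
`c`: the exponential is the strong limit of the exponentials `exp (c B)` of bounded operators
(sums of the usual power series), where `B` runs over the bounded approximations of `A`. -/
def IsOperatorExp {H : Type*} [NormedAddCommGroup H] [InnerProductSpace ℂ H] [CompleteSpace H]
    (c : ℂ) (A : H →ₗ.[ℂ] H) (V : H →L[ℂ] H) : Prop :=
  ∃ B : ℕ → H →L[ℂ] H, (∀ n : ℕ, IsBoundedApprox A (n + 1) (B n)) ∧
    ∀ ψ, Tendsto (fun n => NormedSpace.exp (c • B n) ψ) atTop (𝓝 (V ψ))

/-- `A` is the generator of `U`: its domain is the set of the vectors `ψ` for which `t ↦ U(t) ψ`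
is differentiable at `0`, and then `i ħ (d/dt) U(t) ψ = A ψ` at `t = 0`. -/
def IsGenerator {H : Type*} [NormedAddCommGroup H] [InnerProductSpace ℂ H]
    (ħ : ℝ) (A : H →ₗ.[ℂ] H) (U : ℝ → H →L[ℂ] H) : Prop :=
  (∀ ψ, ψ ∈ A.domain ↔ DifferentiableAt ℝ (fun t => U t ψ) 0) ∧
    ∀ ψ : A.domain, (Complex.I * ħ) • deriv (fun t => U t (ψ : H)) 0 = A ψ

/-- The Schrödinger equation `i ħ dψ/dt = A ψ(t)`, in `H`, at all times. -/
def SchrodingerEquation {H : Type*} [NormedAddCommGroup H] [InnerProductSpace ℂ H]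
    (ħ : ℝ) (A : H →ₗ.[ℂ] H) (ψ : ℝ → H) : Prop :=
  ∀ t, ∃ h : ψ t ∈ A.domain, ∃ ψ' : H, HasDerivAt ψ ψ' t ∧ (Complex.I * ħ) • ψ' = A ⟨ψ t, h⟩

/-- The Schrödinger equation tested against the domain of `A` (self-adjoint):
`i ħ (d/dt) ⟨φ, ψ(t)⟩ = ⟨A φ, ψ(t)⟩`. -/
def WeakSchrodingerEquation {H : Type*} [NormedAddCommGroup H] [InnerProductSpace ℂ H]
    (ħ : ℝ) (A : H →ₗ.[ℂ] H) (ψ : ℝ → H) : Prop :=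
  ∀ (φ : A.domain) (t : ℝ), ∃ z : ℂ,
    HasDerivAt (fun s => inner ℂ (φ : H) (ψ s)) z t ∧ (Complex.I * ħ) * z = inner ℂ (A φ) (ψ t)

/-- The observable `Ŷ(t) = Û(t) Ŷ Û(t)*` of the observer whose clock is displaced by `t`. -/
def evolvedObservable {H : Type*} [NormedAddCommGroup H] [InnerProductSpace ℂ H] [CompleteSpace H]
    (U : ℝ → H →L[ℂ] H) (Y : H →L[ℂ] H) (t : ℝ) : H →L[ℂ] H :=
  U t * Y * star (U t)

/-- The Heisenberg equation `i ħ dY/dt = [A, Y(t)]`, on the natural domain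
`{ψ ∈ dom A | Y(t) ψ ∈ dom A}` of the commutator. -/
def HeisenbergEquation {H : Type*} [NormedAddCommGroup H] [InnerProductSpace ℂ H]
    (ħ : ℝ) (A : H →ₗ.[ℂ] H) (Y : ℝ → H →L[ℂ] H) : Prop :=
  ∀ (t : ℝ) (ψ : A.domain) (h : Y t ψ ∈ A.domain), ∃ χ : H,
    HasDerivAt (fun s => Y s (ψ : H)) χ t ∧ (Complex.I * ħ) • χ = A ⟨Y t ψ, h⟩ - Y t (A ψ)

/-- The Heisenberg equation as an equality of sesquilinear forms on the domain of `A`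
(self-adjoint): `i ħ (d/dt) ⟨φ, Y(t) ψ⟩ = ⟨A φ, Y(t) ψ⟩ - ⟨φ, Y(t) A ψ⟩`. -/
def WeakHeisenbergEquation {H : Type*} [NormedAddCommGroup H] [InnerProductSpace ℂ H]
    (ħ : ℝ) (A : H →ₗ.[ℂ] H) (Y : ℝ → H →L[ℂ] H) : Prop :=
  ∀ (φ ψ : A.domain) (t : ℝ), ∃ z : ℂ,
    HasDerivAt (fun s => inner ℂ (φ : H) (Y s (ψ : H))) z t ∧
      (Complex.I * ħ) * z = inner ℂ (A φ) (Y t (ψ : H)) - inner ℂ (φ : H) (Y t (A ψ))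

end

/-! ### Maps that preserve hermitian products -/

section IsometricExtension

variable {V W H : Type*} [AddCommGroup V] [Module ℂ V] [NormedAddCommGroup W]
  [InnerProductSpace ℂ W] [NormedAddCommGroup H] [InnerProductSpace ℂ H]

/-! A map that preserves hermitian products is automatically linear and isometric, so each
conversion law extends to an isometry of the closure of the chart (`exists_isometric_extension`).
The group law is known only on values actually observed. They contain a nonempty open set of `E`,
hence span it (respectively the basis of `ℂ^d`), so the law passes to the extensions, which are then
invertible, hence unitary.

The rest is Stone's theorem. `A` is the derivative of `U` at 0 times `iħ`; unitarity makes it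
symmetric. Laplace-type integrals of orbits show that `A - iμ` is onto for every real `μ ≠ 0`, which
yields self-adjointness, density of the domain and the bounded approximations `B n`. These commute
with `U` and converge to `A` on its domain, so Duhamel's estimate turns this convergence into that
of the exponentials. The equations of motion are product rules, with the group moved onto vectors of
the domain. -/

theorem isLinearMap_of_inner_eq (e : V →ₗ[ℂ] W) (f : V → H)
    (h : ∀ x y, inner ℂ (f x) (f y) = inner ℂ (e x) (e y)) : IsLinearMap ℂ f where
  map_add x y := by
    -- The squared norm of the defect of additivity expands into products of values of `f`; replaced
    -- by those of `e`, they cancel.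
    rw [← sub_eq_zero, ← inner_self_eq_zero (𝕜 := ℂ)]
    simp only [inner_sub_left, inner_sub_right, inner_add_left, inner_add_right, h, map_add]
    ring
  map_smul c x := by
    rw [← sub_eq_zero, ← inner_self_eq_zero (𝕜 := ℂ)]
    simp only [inner_sub_left, inner_sub_right, inner_smul_left, inner_smul_right, h, map_smul]
    ring

theorem norm_eq_of_inner_eq {x : H} {y : W} (h : inner ℂ x x = inner ℂ y y) : ‖x‖ = ‖y‖ := by
  rw [inner_self_eq_norm_sq_to_K, inner_self_eq_norm_sq_to_K] at h
  have h' : ‖x‖ ^ 2 = ‖y‖ ^ 2 := by exact_mod_cast h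
  exact (sq_eq_sq₀ (norm_nonneg _) (norm_nonneg _)).1 h'

theorem exists_isometric_extension [CompleteSpace H] (e : V →ₗ[ℂ] W) (he : DenseRange e)
    (f : V → H) (h : ∀ x y, inner ℂ (f x) (f y) = inner ℂ (e x) (e y)) :
    ∃ T : W →L[ℂ] H, (∀ x, T (e x) = f x) ∧ ∀ y, ‖T y‖ = ‖y‖ := by
  let F : V →ₗ[ℂ] H := (isLinearMap_of_inner_eq e f h).mk' f
  have hF : ∀ x, F x = f x := fun _ => rfl
  have hn : ∀ x, ‖F x‖ ≤ 1 * ‖e x‖ := fun x => by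
    rw [hF, norm_eq_of_inner_eq (h x x), one_mul]
  have hT : ∀ x, F.extendOfNorm e (e x) = f x := fun x => by
    rw [LinearMap.extendOfNorm_eq he ⟨1, hn⟩, hF]
  refine ⟨F.extendOfNorm e, hT, fun y => ?_⟩
  refine he.induction_on (p := fun y => ‖F.extendOfNorm e y‖ = ‖y‖) y ?_ fun x => ?_
  · exact isClosed_eq (by fun_prop) (by fun_prop)
  · rw [hT, norm_eq_of_inner_eq (h x x)]

end IsometricExtension

/-! ### Unitary groups and their transport by isometries -/

section UnitaryGroup

variable {H : Type*} [NormedAddCommGroup H] [InnerProductSpace ℂ H] [CompleteSpace H]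

namespace IsUnitaryGroup

variable {U : ℝ → H →L[ℂ] H}

omit [CompleteSpace H] in
theorem neg_mul_self (hz : U 0 = 1) (ha : ∀ s t, U (s + t) = U s * U t) (t : ℝ) :
    U (-t) * U t = 1 := by
  rw [← ha, neg_add_cancel, hz]

/-- The group law supplies the inverse `U (-t)`, and an invertible isometry is unitary. -/
theorem of_norm_map (hn : ∀ t ψ, ‖U t ψ‖ = ‖ψ‖) (hz : U 0 = 1)
    (ha : ∀ s t, U (s + t) = U s * U t) : IsUnitaryGroup U where
  unitary t := by
    have h1 : star (U t) * U t = 1 := (U t).norm_map_iff_adjoint_comp_self.1 (hn t)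
    have h2 : U t * U (-t) = 1 := by simpa using neg_mul_self hz ha (-t)
    have h3 : star (U t) = U (-t) := left_inv_eq_right_inv h1 h2
    exact Unitary.mem_iff.2 ⟨h1, h3 ▸ h2⟩
  zero := hz
  add := ha

variable (hU : IsUnitaryGroup U)
include hU

theorem star_eq (t : ℝ) : star (U t) = U (-t) :=
  left_inv_eq_right_inv (Unitary.star_mul_self_of_mem (hU.unitary t))
    (by simpa using neg_mul_self hU.zero hU.add (-t))

theorem norm_map (t : ℝ) (ψ : H) : ‖U t ψ‖ = ‖ψ‖ :=
  ContinuousLinearMap.norm_map_of_mem_unitary (hU.unitary t) ψ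

theorem inner_map_map (t : ℝ) (φ ψ : H) : inner ℂ (U t φ) (U t ψ) = inner ℂ φ ψ :=
  ContinuousLinearMap.inner_map_map_of_mem_unitary (hU.unitary t) φ ψ

theorem zero_apply (ψ : H) : U 0 ψ = ψ := by simp [hU.zero]

theorem add_apply (s t : ℝ) (ψ : H) : U (s + t) ψ = U s (U t ψ) := by simp [hU.add]

theorem neg_apply_apply (t : ℝ) (ψ : H) : U (-t) (U t ψ) = ψ := by
  rw [← hU.add_apply, neg_add_cancel, hU.zero_apply]

theorem apply_neg_apply (t : ℝ) (ψ : H) : U t (U (-t) ψ) = ψ := by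
  rw [← hU.add_apply, add_neg_cancel, hU.zero_apply]

theorem inner_map_left (t : ℝ) (φ ψ : H) : inner ℂ (U t φ) ψ = inner ℂ φ (U (-t) ψ) := by
  rw [← hU.inner_map_map (-t), hU.neg_apply_apply]

theorem evolvedObservable_apply (Y : H →L[ℂ] H) (t : ℝ) (ψ : H) :
    evolvedObservable U Y t ψ = U t (Y (U (-t) ψ)) := by
  simp [evolvedObservable, hU.star_eq]

theorem evolvedObservable_apply_apply (Y : H →L[ℂ] H) (t : ℝ) (ψ : H) :
    evolvedObservable U Y t (U t ψ) = U t (Y ψ) := by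
  rw [hU.evolvedObservable_apply, hU.neg_apply_apply]

end IsUnitaryGroup

/-- A unitary group of a Hilbert space `K`, transported by an isometry `J : K → H` and extended by
the identity on the orthogonal complement of the range of `J`. -/
theorem exists_isUnitaryGroup_of_isometry {K : Type*} [NormedAddCommGroup K]
    [InnerProductSpace ℂ K] [CompleteSpace K] (J : K →L[ℂ] H) (hJ : ∀ v, ‖J v‖ = ‖v‖)
    {V : ℝ → K →L[ℂ] K} (hV : IsUnitaryGroup V) :
    ∃ U : ℝ → H →L[ℂ] H, IsUnitaryGroup U ∧ ∀ t v, U t (J v) = J (V t v) := by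
  have hJJ : ∀ v, J.adjoint (J v) = v := fun v =>
    DFunLike.congr_fun (J.norm_map_iff_adjoint_comp_self.1 hJ) v
  let U : ℝ → H →L[ℂ] H := fun t => J ∘L V t ∘L J.adjoint + (1 - J ∘L J.adjoint)
  have hUa : ∀ t ψ, U t ψ = J (V t (J.adjoint ψ)) + (ψ - J (J.adjoint ψ)) := fun _ _ => rfl
  refine ⟨U, .of_norm_map (fun t ψ => ?_) ?_ fun s t => ?_, fun t v => ?_⟩
  -- Pythagoras, before and after `V t` acts on the component in the range of `J`.
  · have horth : ∀ v, inner ℂ (J v) (ψ - J (J.adjoint ψ)) = 0 := fun v => by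
      rw [← ContinuousLinearMap.adjoint_inner_right, map_sub, hJJ, sub_self, inner_zero_right]
    have h1 := norm_add_sq_eq_norm_sq_add_norm_sq_of_inner_eq_zero _ _ (horth (V t (J.adjoint ψ)))
    have h2 := norm_add_sq_eq_norm_sq_add_norm_sq_of_inner_eq_zero _ _ (horth (J.adjoint ψ))
    rw [hJ, hV.norm_map] at h1
    rw [hJ, add_sub_cancel] at h2
    rw [hUa]
    nlinarith [norm_nonneg (J (V t (J.adjoint ψ)) + (ψ - J (J.adjoint ψ))), norm_nonneg ψ]
  · ext ψ
    simp [hUa, hV.zero]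
  · ext ψ
    simp [hUa, hV.add, hJJ]
  · simp [hUa, hJJ]

end UnitaryGroup

/-! ### From conversion laws to unitary groups -/

namespace GalileanModel

variable {M E H : Type*} [NormedAddCommGroup E] [NormedSpace ℂ E]
  [NormedAddCommGroup H] [InnerProductSpace ℂ H] {d : ℕ}

theorem chartD_inner (S : GalileanModel M E H d) (v w : EuclideanSpace ℂ (Fin d)) :
    inner ℂ (S.chartD v) (S.chartD w) = inner ℂ v w := by
  rw [chartD, chartD, S.label_orthonormal.inner_sum, PiLp.inner_apply]
  simp [mul_comm]

theorem exists_isometry_eq_chartD (S : GalileanModel M E H d) :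
    ∃ J : EuclideanSpace ℂ (Fin d) →L[ℂ] H, (∀ v, J v = S.chartD v) ∧ ∀ v, ‖J v‖ = ‖v‖ := by
  let F : EuclideanSpace ℂ (Fin d) →ₗ[ℂ] H :=
    (isLinearMap_of_inner_eq (H := H) LinearMap.id S.chartD S.chartD_inner).mk' S.chartD
  exact ⟨LinearMap.toContinuousLinearMap F, fun _ => rfl,
    fun v => norm_eq_of_inner_eq (S.chartD_inner v v)⟩

theorem exists_configuration (S : GalileanModel M E H d) {k : Fin d} {x : E}
    (hx : x ∈ S.states k) : ∃ m, S.D 0 m = EuclideanSpace.single k 1 ∧ S.X 0 m = x := by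
  have h : (EuclideanSpace.single k (1 : ℂ), x) ∈ Set.range fun m => (S.D 0 m, S.X 0 m) := by
    rw [S.range_reference]
    exact ⟨k, rfl, hx⟩
  obtain ⟨m, hm⟩ := h
  exact ⟨m, congrArg Prod.fst hm, congrArg Prod.snd hm⟩

theorem exists_configuration_D (S : GalileanModel M E H d) (k : Fin d) :
    ∃ m, S.D 0 m = EuclideanSpace.single k 1 := by
  obtain ⟨x, hx⟩ := S.states_nonempty k
  obtain ⟨m, hm, -⟩ := S.exists_configuration hx
  exact ⟨m, hm⟩

/-- A subspace with nonempty interior is the whole space, and the initial values cover the open set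
`states 0`. -/
theorem eq_top_of_forall_X_mem [NeZero d] (S : GalileanModel M E H d) (p : Submodule ℂ E)
    (hp : ∀ m, S.X 0 m ∈ p) : p = ⊤ := by
  refine p.eq_top_of_nonempty_interior' ((S.states_nonempty 0).mono ?_)
  refine interior_maximal (fun x hx => ?_) (S.states_isOpen 0)
  obtain ⟨m, -, rfl⟩ := S.exists_configuration hx
  exact hp m

/-- Bounded operators are determined by their values on the initial values of the evolutions. -/
theorem clm_ext [NeZero d] (S : GalileanModel M E H d) {T T' : H →L[ℂ] H}
    (h : ∀ m, T (S.chart (S.X 0 m)) = T' (S.chart (S.X 0 m))) : T = T' := by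
  have htop := S.eq_top_of_forall_X_mem
    (LinearMap.eqLocus ((T : H →ₗ[ℂ] H) ∘ₗ S.chart) ((T' : H →ₗ[ℂ] H) ∘ₗ S.chart)) h
  refine DFunLike.coe_injective (S.chart_denseRange.equalizer T.continuous T'.continuous ?_)
  funext x
  exact htop.ge (Submodule.mem_top (x := x))

theorem exists_unitaryGroup_continuous [CompleteSpace H] [NeZero d] (S : GalileanModel M E H d) :
    ∃ U : ℝ → H →L[ℂ] H, IsUnitaryGroup U ∧ ∀ t x, U t (S.chart x) = S.chart (S.conv t x) := by
  choose U hU hn using fun t => exists_isometric_extension S.chart S.chart_denseRange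
    (fun x => S.chart (S.conv t x)) (S.inner_conv t)
  refine ⟨U, .of_norm_map hn (S.clm_ext fun m => ?_) fun s t => S.clm_ext fun m => ?_, hU⟩
  · rw [hU, ← S.X_add, zero_add, one_apply_eq_self]
  -- `conv` is not assumed to be a group action: both sides are the value found by the observer `s +
  -- t` in the configuration `m`.
  · rw [mul_apply_eq_comp, hU, hU, hU, ← S.X_add, ← S.X_add, ← S.X_add, zero_add,
      zero_add, add_comm]

theorem exists_unitaryGroup_discrete [CompleteSpace H] (S : GalileanModel M E H d) :
    ∃ U : ℝ → H →L[ℂ] H, IsUnitaryGroup U ∧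
      ∀ t v, U t (S.chartD v) = S.chartD (S.convD t v) := by
  choose V hV hn using fun t => exists_isometric_extension
    (LinearMap.id : EuclideanSpace ℂ (Fin d) →ₗ[ℂ] _) Function.surjective_id.denseRange
    (S.convD t) (S.inner_convD t)
  have hext : ∀ {T T' : EuclideanSpace ℂ (Fin d) →L[ℂ] EuclideanSpace ℂ (Fin d)},
      (∀ m, T (S.D 0 m) = T' (S.D 0 m)) → T = T' := fun {T T'} h => by
    refine ContinuousLinearMap.coe_injective
      ((EuclideanSpace.basisFun (Fin d) ℂ).toBasis.ext fun k => ?_)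
    -- Every basis vector is an initial value, because no `states k` is empty.
    obtain ⟨m, hm⟩ := S.exists_configuration_D k
    simpa [hm] using h m
  simp only [LinearMap.id_apply] at hV
  have hVg : IsUnitaryGroup V := by
    refine .of_norm_map hn (hext fun m => ?_) fun s t => hext fun m => ?_
    · rw [hV, ← S.D_add, zero_add, one_apply_eq_self]
    · rw [mul_apply_eq_comp, hV, hV, hV, ← S.D_add, ← S.D_add, ← S.D_add, zero_add,
        zero_add, add_comm]
  obtain ⟨J, hJ, hJn⟩ := S.exists_isometry_eq_chartD
  obtain ⟨U, hU, hUJ⟩ := exists_isUnitaryGroup_of_isometry J hJn hVg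
  exact ⟨U, hU, fun t v => by rw [← hJ, hUJ, hV, hJ]⟩

end GalileanModel

/-! ### Strong limits of contractions -/

section StrongLimits

variable {H : Type*} [NormedAddCommGroup H] [InnerProductSpace ℂ H]

theorem tendsto_apply_of_dense {ι : Type*} {l : Filter ι} {T : ι → H →L[ℂ] H} {L : H →L[ℂ] H}
    (hT : ∀ i x, ‖T i x‖ ≤ ‖x‖) (hL : ∀ x, ‖L x‖ ≤ ‖x‖) {s : Set H} (hs : Dense s)
    (h : ∀ x ∈ s, Tendsto (fun i => T i x) l (𝓝 (L x))) (x : H) :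
    Tendsto (fun i => T i x) l (𝓝 (L x)) := by
  rw [Metric.tendsto_nhds]
  intro ε hε
  obtain ⟨y, hy, hxy⟩ := Metric.dense_iff.1 hs x (ε / 3) (by positivity)
  filter_upwards [Metric.tendsto_nhds.1 (h _ hxy) (ε / 3) (by positivity)] with i hi
  rw [Metric.mem_ball, dist_comm, dist_eq_norm] at hy
  rw [dist_eq_norm] at hi ⊢
  have h1 := hT i (x - y)
  have h2 := hL (x - y)
  have h3 : T i x - L x = T i (x - y) + (T i y - L y) - L (x - y) := by
    simp only [map_sub]; abel
  calc ‖T i x - L x‖ ≤ ‖T i (x - y)‖ + ‖T i y - L y‖ + ‖L (x - y)‖ := by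
        rw [h3]; exact (norm_sub_le _ _).trans (by gcongr; exact norm_add_le _ _)
    _ < ε := by linarith

/-- The product rule for a strongly continuous family of contractions. -/
theorem HasDerivAt.contraction_apply {V : ℝ → H →L[ℂ] H} {f : ℝ → H} {f' g : H} {t : ℝ}
    (hV : ∀ s x, ‖V s x‖ ≤ ‖x‖) (hc : ∀ x, ContinuousAt (fun s => V s x) t)
    (hf : HasDerivAt f f' t) (hg : HasDerivAt (fun s => V s (f t)) g t) :
    HasDerivAt (fun s => V s (f s)) (V t f' + g) t := by
  rw [hasDerivAt_iff_tendsto_slope] at hf hg ⊢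
  -- The first term tends to 0 because `V s` is a contraction, so strong continuity suffices.
  have hslope : slope (fun s => V s (f s)) t =
      fun s => (V s (slope f t s - f') + V s f') + slope (fun s => V s (f t)) t s := by
    funext s
    simp only [slope_def_module, map_sub, ContinuousLinearMap.map_smul_of_tower, smul_sub]
    abel
  rw [hslope]
  have h0 : Tendsto (fun s => V s (slope f t s - f')) (𝓝[≠] t) (𝓝 0) :=
    squeeze_zero_norm (fun s => hV s _)
      (by simpa using (hf.sub (tendsto_const_nhds (x := f'))).norm)
  simpa using (h0.add ((hc f').tendsto.mono_left nhdsWithin_le_nhds)).add hg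

end StrongLimits

/-! ### Symmetric operators, resolvents and bounded approximations -/

section SymmetricOperator

variable {H : Type*} [NormedAddCommGroup H] [InnerProductSpace ℂ H] {A : H →ₗ.[ℂ] H}

theorem LinearPMap.IsFormalAdjoint.inner_sub_smul (hA : A.IsFormalAdjoint A) (z : ℂ)
    (u v : A.domain) :
    inner ℂ (A u - z • (u : H)) (v : H) =
      inner ℂ (u : H) (A v - (starRingEnd ℂ z) • (v : H)) := by
  rw [inner_sub_left, inner_sub_right, inner_smul_left, inner_smul_right, hA u v]

/-- Since `⟨u, A u⟩` is real, `⟨u, (A - iμ) u⟩` has imaginary part `-μ‖u‖²`; Cauchy–Schwarz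
concludes. -/
theorem LinearPMap.IsFormalAdjoint.abs_mul_norm_le (hA : A.IsFormalAdjoint A) (μ : ℝ)
    (u : A.domain) : |μ| * ‖(u : H)‖ ≤ ‖A u - (Complex.I * μ) • (u : H)‖ := by
  have him : (inner ℂ (u : H) (A u)).im = 0 := by
    rw [← Complex.conj_eq_iff_im, inner_conj_symm]
    exact hA u u
  have h1 : (inner ℂ (u : H) (A u - (Complex.I * μ) • (u : H))).im = -(μ * ‖(u : H)‖ ^ 2) := by
    rw [inner_sub_right, inner_smul_right, inner_self_eq_norm_sq_to_K, Complex.sub_im, him]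
    simp [← Complex.ofReal_pow]
  have h2 : |μ| * ‖(u : H)‖ ^ 2 ≤ ‖(u : H)‖ * ‖A u - (Complex.I * μ) • (u : H)‖ := by
    calc |μ| * ‖(u : H)‖ ^ 2 = |(inner ℂ (u : H) (A u - (Complex.I * μ) • (u : H))).im| := by
          rw [h1, abs_neg, abs_mul, abs_of_nonneg (sq_nonneg ‖(u : H)‖)]
      _ ≤ _ := (Complex.abs_im_le_norm _).trans (norm_inner_le_norm _ _)
  rcases (norm_nonneg (u : H)).eq_or_lt with h | h
  · rw [← h, mul_zero]; exact norm_nonneg _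
  · exact le_of_mul_le_mul_left (by linarith) h

theorem LinearPMap.IsFormalAdjoint.dense_domain [CompleteSpace H] (hA : A.IsFormalAdjoint A)
    {z : ℂ} (h1 : ∀ x, ∃ u : A.domain, A u - z • (u : H) = x)
    (h2 : ∀ x, ∃ u : A.domain, A u - (starRingEnd ℂ z) • (u : H) = x) :
    Dense (A.domain : Set H) := by
  rw [Submodule.dense_iff_topologicalClosure_eq_top, Submodule.topologicalClosure_eq_top_iff,
    Submodule.eq_bot_iff]
  intro φ hφ
  -- With `v = (A - z)u`, symmetry gives `⟨v, v⟩ = ⟨u, φ⟩ = 0`.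
  obtain ⟨v, hv⟩ := h2 φ
  have hv0 : (v : H) = 0 := by
    obtain ⟨u, hu⟩ := h1 v
    rw [← inner_self_eq_zero (𝕜 := ℂ)]
    nth_rewrite 1 [← hu]
    rw [hA.inner_sub_smul, hv]
    exact (Submodule.mem_orthogonal _ _).1 hφ u u.2
  rw [← hv, Submodule.coe_eq_zero.1 hv0]
  simp

theorem LinearPMap.IsFormalAdjoint.isSelfAdjoint [CompleteSpace H] (hA : A.IsFormalAdjoint A)
    {z : ℂ} (h1 : ∀ x, ∃ u : A.domain, A u - z • (u : H) = x)
    (h2 : ∀ x, ∃ u : A.domain, A u - (starRingEnd ℂ z) • (u : H) = x) : IsSelfAdjoint A := by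
  have hd := hA.dense_domain h1 h2
  rw [LinearPMap.isSelfAdjoint_def]
  have hle : A ≤ A.adjoint := hA.le_adjoint hd
  refine (LinearPMap.eq_of_le_of_domain_eq hle (le_antisymm hle.1 fun φ hφ => ?_)).symm
  -- Then `φ - u` lies in the kernel of `A* - z`, which is orthogonal to the range of `A - conj z`,
  -- that is, to everything.
  obtain ⟨u, hu⟩ := h1 (A.adjoint ⟨φ, hφ⟩ - z • φ)
  have hzero : φ - u = 0 := by
    obtain ⟨v, hv⟩ := h2 (φ - u)
    rw [← inner_self_eq_zero (𝕜 := ℂ)]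
    nth_rewrite 2 [← hv]
    rw [inner_sub_left, ← hA.inner_sub_smul, hu, inner_sub_right, inner_smul_right,
      inner_sub_left, inner_smul_left, LinearPMap.adjoint_isFormalAdjoint hd ⟨φ, hφ⟩ v, sub_self]
  rw [sub_eq_zero.1 hzero]
  exact u.2

theorem LinearPMap.IsFormalAdjoint.exists_isResolvent (hA : A.IsFormalAdjoint A) {μ : ℝ}
    (hμ : μ ≠ 0) (h : ∀ x, ∃ u : A.domain, A u - (Complex.I * μ) • (u : H) = x) :
    ∃ R : H →L[ℂ] H, IsResolvent A (Complex.I * μ) R := by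
  let L : A.domain →ₗ[ℂ] H := A.toFun - (Complex.I * μ) • A.domain.subtype
  have hL : ∀ u, L u = A u - (Complex.I * μ) • (u : H) := fun _ => rfl
  have hinj : Function.Injective L := by
    rw [injective_iff_map_eq_zero]
    intro u hu
    have := hA.abs_mul_norm_le μ u
    rw [← hL, hu, norm_zero] at this
    have h0 : ‖(u : H)‖ = 0 := le_antisymm
      (nonpos_of_mul_nonpos_right this (abs_pos.2 hμ)) (norm_nonneg _)
    exact Submodule.coe_eq_zero.1 (norm_eq_zero.1 h0)
  let e : A.domain ≃ₗ[ℂ] H := LinearEquiv.ofBijective L ⟨hinj, h⟩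
  have he : ∀ u, e u = A u - (Complex.I * μ) • (u : H) := hL
  refine ⟨(A.domain.subtype ∘ₗ e.symm.toLinearMap).mkContinuous |μ|⁻¹ fun x => ?_,
    fun ψ => ⟨(e.symm ψ).2, ?_⟩, fun φ => ?_⟩
  · have := hA.abs_mul_norm_le μ (e.symm x)
    rw [← he, e.apply_symm_apply] at this
    rw [inv_mul_eq_div, le_div_iff₀ (abs_pos.2 hμ), mul_comm]
    exact this
  · exact (he (e.symm ψ)).symm.trans (e.apply_symm_apply ψ)
  · rw [← he]
    exact congrArg Subtype.val (e.symm_apply_apply φ)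

namespace IsResolvent

theorem abs_mul_norm_le (hA : A.IsFormalAdjoint A) {μ : ℝ} {R : H →L[ℂ] H}
    (hR : IsResolvent A (Complex.I * μ) R) (x : H) : |μ| * ‖R x‖ ≤ ‖x‖ := by
  obtain ⟨h, hx⟩ := hR.1 x
  simpa only [hx] using hA.abs_mul_norm_le μ ⟨R x, h⟩

theorem inner_left (hA : A.IsFormalAdjoint A) {z : ℂ} {R R' : H →L[ℂ] H}
    (hR : IsResolvent A z R) (hR' : IsResolvent A (starRingEnd ℂ z) R') (x y : H) :
    inner ℂ (R x) y = inner ℂ x (R' y) := by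
  obtain ⟨h, hx⟩ := hR.1 x
  obtain ⟨h', hy⟩ := hR'.1 y
  nth_rewrite 1 [← hy]
  rw [← hA.inner_sub_smul z ⟨R x, h⟩ ⟨R' y, h'⟩, hx]

theorem apply_comm {z : ℂ} {R T : H →L[ℂ] H} (hR : IsResolvent A z R)
    (hT : ∀ ψ : A.domain, ∃ h : T ψ ∈ A.domain, A ⟨T ψ, h⟩ = T (A ψ)) (x : H) :
    R (T x) = T (R x) := by
  obtain ⟨h, hx⟩ := hR.1 x
  obtain ⟨h', hx'⟩ := hT ⟨R x, h⟩
  have := hR.2 ⟨T (R x), h'⟩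
  rwa [hx', ← map_smul, ← map_sub, hx] at this

theorem smul_apply_domain {μ : ℝ} {R : H →L[ℂ] H} (hR : IsResolvent A (Complex.I * μ) R)
    (φ : A.domain) : (μ : ℂ) • R φ = Complex.I • (φ : H) - Complex.I • R (A φ) := by
  have h := hR.2 φ
  rw [map_sub, map_smul, sub_eq_iff_eq_add] at h
  rw [h, smul_add, smul_smul, ← mul_assoc, Complex.I_mul_I]
  simp

/-- The operators `μ R` are contractions, so it is enough to argue on the domain, where `μ R φ = iφ
- i R (A φ)` and `R (A φ)` is `O(1/|μ|)`. -/
theorem tendsto_smul_apply (hA : A.IsFormalAdjoint A) (hd : Dense (A.domain : Set H))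
    {μ : ℕ → ℝ} (hμ : Tendsto (fun n => |μ n|) atTop atTop) {R : ℕ → H →L[ℂ] H}
    (hR : ∀ n, IsResolvent A (Complex.I * μ n) (R n)) (x : H) :
    Tendsto (fun n => (μ n : ℂ) • R n x) atTop (𝓝 (Complex.I • x)) := by
  refine tendsto_apply_of_dense (T := fun n => (μ n : ℂ) • R n)
    (L := Complex.I • ContinuousLinearMap.id ℂ H) (fun n y => ?_) (fun y => ?_) hd
    (fun φ hφ => ?_) x
  · simpa [norm_smul] using (hR n).abs_mul_norm_le hA y
  · simp [norm_smul]
  · have h0 : Tendsto (fun n => R n (A ⟨φ, hφ⟩)) atTop (𝓝 0) := by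
      refine squeeze_zero_norm' (a := fun n => ‖A ⟨φ, hφ⟩‖ / |μ n|) ?_
        (tendsto_const_nhds.div_atTop hμ)
      filter_upwards [hμ.eventually_gt_atTop 0] with n hn
      rw [le_div_iff₀ hn, mul_comm]
      exact (hR n).abs_mul_norm_le hA _
    have h1 := (tendsto_const_nhds (x := Complex.I • φ)).sub (h0.const_smul Complex.I)
    simp only [smul_zero, sub_zero] at h1
    exact h1.congr fun n => ((hR n).smul_apply_domain ⟨φ, hφ⟩).symm

end IsResolvent

theorem exists_isBoundedApprox (hA : A.IsFormalAdjoint A)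
    (hs : ∀ μ : ℝ, μ ≠ 0 → ∀ x, ∃ u : A.domain, A u - (Complex.I * μ) • (u : H) = x)
    {n : ℝ} (hn : n ≠ 0) : ∃ B, IsBoundedApprox A n B := by
  obtain ⟨R₁, h₁⟩ := hA.exists_isResolvent hn (hs n hn)
  obtain ⟨R₂, h₂⟩ := hA.exists_isResolvent (neg_ne_zero.2 hn) (hs (-n) (neg_ne_zero.2 hn))
  exact ⟨_, R₁, R₂, h₁, by simpa using h₂, rfl⟩

namespace IsBoundedApprox

theorem isSelfAdjoint [CompleteSpace H] (hA : A.IsFormalAdjoint A) {n : ℝ} {B : H →L[ℂ] H}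
    (hB : IsBoundedApprox A n B) : IsSelfAdjoint B := by
  obtain ⟨R₁, R₂, h₁, h₂, rfl⟩ := hB
  rw [ContinuousLinearMap.isSelfAdjoint_iff_isSymmetric]
  intro x y
  have h12 := h₁.inner_left hA (R' := R₂) (by simpa using h₂) x y
  have h21 := h₂.inner_left hA (R' := R₁) (by simpa using h₁) x y
  have hr : (starRingEnd ℂ) ((n : ℂ) ^ 2 / 2) = (n : ℂ) ^ 2 / 2 := by
    rw [map_div₀, map_pow, Complex.conj_ofReal, map_ofNat]
  simp only [ContinuousLinearMap.coe_coe, smul_apply,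
    add_apply, inner_smul_left, inner_smul_right, inner_add_left,
    inner_add_right, h12, h21, hr]
  ring

theorem apply_comm {n : ℝ} {B T : H →L[ℂ] H} (hB : IsBoundedApprox A n B)
    (hT : ∀ ψ : A.domain, ∃ h : T ψ ∈ A.domain, A ⟨T ψ, h⟩ = T (A ψ)) (x : H) :
    B (T x) = T (B x) := by
  obtain ⟨R₁, R₂, h₁, h₂, rfl⟩ := hB
  simp [h₁.apply_comm hT, h₂.apply_comm hT]

theorem tendsto_apply (hA : A.IsFormalAdjoint A) (hd : Dense (A.domain : Set H))
    {B : ℕ → H →L[ℂ] H} (hB : ∀ n : ℕ, IsBoundedApprox A (n + 1) (B n)) (ψ : A.domain) :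
    Tendsto (fun n => B n ψ) atTop (𝓝 (A ψ)) := by
  choose R₁ R₂ h₁ h₂ hBR using hB
  have h₁' : ∀ n : ℕ, IsResolvent A (Complex.I * ((n + 1 : ℝ) : ℂ)) (R₁ n) := h₁
  have h₂' : ∀ n : ℕ, IsResolvent A (Complex.I * ((-(n + 1) : ℝ) : ℂ)) (R₂ n) := fun n => by
    simpa only [Complex.ofReal_neg, mul_neg] using h₂ n
  have hlim : Tendsto (fun n : ℕ => |(n + 1 : ℝ)|) atTop atTop :=
    tendsto_abs_atTop_atTop.comp (tendsto_natCast_atTop_atTop.atTop_add tendsto_const_nhds)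
  have t₁ := IsResolvent.tendsto_smul_apply hA hd hlim h₁' (A ψ)
  have t₂ := IsResolvent.tendsto_smul_apply hA hd (by simpa only [abs_neg] using hlim) h₂' (A ψ)
  -- On the domain, with `n + 1` as parameter, `B n ψ = -(i/2)((n+1) R₁ - (n+1) R₂) A ψ`.
  have t := (t₁.add t₂).const_smul (-Complex.I / 2)
  have hl : (-Complex.I / 2) • (Complex.I • A ψ + Complex.I • A ψ) = A ψ := by
    rw [← two_smul ℂ, smul_smul, smul_smul]
    have : -Complex.I / 2 * 2 * Complex.I = 1 := by linear_combination -Complex.I_mul_I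
    rw [this, one_smul]
  rw [hl] at t
  refine t.congr fun n => ?_
  have e₁ := (h₁' n).smul_apply_domain ψ
  have e₂ := (h₂' n).smul_apply_domain ψ
  have hs : B n ψ = (((n + 1 : ℝ) : ℂ) / 2) • (((n + 1 : ℝ) : ℂ) • R₁ n ψ -
      ((-(n + 1) : ℝ) : ℂ) • R₂ n ψ) := by
    rw [hBR]
    simp only [smul_apply, add_apply]
    push_cast
    module
  rw [hs, e₁, e₂]
  push_cast
  module

end IsBoundedApprox

theorem exp_mem_unitary_of_isSelfAdjoint [CompleteSpace H] {B : H →L[ℂ] H} (hB : IsSelfAdjoint B)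
    {c : ℂ} (hc : starRingEnd ℂ c = -c) : NormedSpace.exp (c • B) ∈ unitary (H →L[ℂ] H) := by
  let +nondep : NormedAlgebra ℚ (H →L[ℂ] H) := .restrictScalars ℚ ℂ _
  exact NormedSpace.exp_mem_unitary_of_mem_skewAdjoint (hB.smul_mem_skewAdjoint hc)

end SymmetricOperator

/-! ### Stone's theorem and the equations of motion -/

section Stone

variable {H : Type*} [NormedAddCommGroup H] [InnerProductSpace ℂ H] [CompleteSpace H]

/-- The operator `i ħ d/dt U(t)` at `t = 0`, on its natural domain. -/
noncomputable def hamiltonian (ħ : ℝ) (U : ℝ → H →L[ℂ] H) : H →ₗ.[ℂ] H where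
  domain :=
    { carrier := {ψ | DifferentiableAt ℝ (fun t => U t ψ) 0}
      add_mem' := fun {φ ψ} hφ hψ => by simpa using hφ.fun_add hψ
      zero_mem' := by simp
      smul_mem' := fun c ψ hψ => by simpa using hψ.fun_const_smul c }
  toFun :=
    { toFun := fun ψ => (Complex.I * ħ) • deriv (fun t => U t (ψ : H)) 0
      map_add' := fun φ ψ => by
        rw [← smul_add, ← deriv_fun_add φ.2 ψ.2]
        simp
      map_smul' := fun c ψ => by
        rw [RingHom.id_apply, smul_comm c, ← deriv_fun_const_smul c ψ.2]
        simp }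

omit [CompleteSpace H] in
theorem isGenerator_hamiltonian (ħ : ℝ) (U : ℝ → H →L[ℂ] H) :
    IsGenerator ħ (hamiltonian ħ U) U :=
  ⟨fun _ => Iff.rfl, fun _ => rfl⟩

omit [CompleteSpace H] in
theorem hamiltonian_apply_eq_iff_hasDerivAt {ħ : ℝ} (hħ : 0 < ħ)
    {U : ℝ → H →L[ℂ] H} {ψ g : H} :
    (∃ h : ψ ∈ (hamiltonian ħ U).domain, hamiltonian ħ U ⟨ψ, h⟩ = (Complex.I * ħ) • g) ↔
      HasDerivAt (fun t => U t ψ) g 0 := by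
  have hne : Complex.I * (ħ : ℂ) ≠ 0 := by simp [hħ.ne']
  constructor
  · rintro ⟨h, hg⟩
    have h' : deriv (fun t => U t ψ) 0 = g := smul_right_injective H hne hg
    exact h' ▸ DifferentiableAt.hasDerivAt h
  · intro h
    exact ⟨h.differentiableAt, congrArg ((Complex.I * (ħ : ℂ)) • ·) h.deriv⟩

theorem IsUnitaryGroup.continuous_of_dense {U : ℝ → H →L[ℂ] H} (hU : IsUnitaryGroup U) {s : Set H}
    (hs : Dense s) (h : ∀ ψ ∈ s, Continuous fun t => U t ψ) (ψ : H) :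
    Continuous fun t => U t ψ :=
  continuous_iff_continuousAt.2 fun t =>
    tendsto_apply_of_dense (fun t x => (hU.norm_map t x).le) (fun x => (hU.norm_map t x).le) hs
      (fun x hx => (h x hx).continuousAt) ψ

theorem IsUnitaryGroup.hasDerivAt {U : ℝ → H →L[ℂ] H} (hU : IsUnitaryGroup U) {ψ g : H}
    (h : HasDerivAt (fun t => U t ψ) g 0) (t : ℝ) : HasDerivAt (fun s => U s ψ) (U t g) t := by
  have h1 : HasDerivAt (fun s => U (s - t) ψ) g t := by
    simpa using HasDerivAt.comp_sub_const t t (f := fun s => U s ψ) (by simpa using h)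
  refine ((((U t).restrictScalars ℝ).hasFDerivAt.comp_hasDerivAt t h1).congr_of_eventuallyEq
    (Eventually.of_forall fun s => ?_))
  simp [← hU.add_apply]

/-- The vector `∫₀^{1/μ} exp (-μ t) U(t) y dt` solves the resolvent equation, up to a contraction
which is inverted by a Neumann series. -/
theorem IsUnitaryGroup.exists_smul_sub_deriv_eq {U : ℝ → H →L[ℂ] H} (hU : IsUnitaryGroup U)
    (hc : ∀ ψ, Continuous fun t => U t ψ) {μ : ℝ} (hμ : μ ≠ 0) (x : H) :
    ∃ u g, HasDerivAt (fun t => U t u) g 0 ∧ μ • u - g = x := by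
  -- The boundary term of the integral. Stopping at `1/μ` makes the factor `exp (-1)` for either
  -- sign of `μ`, hence a strict contraction.
  obtain ⟨y, hy⟩ : ∃ y, y - Real.exp (-1) • U μ⁻¹ y = x := by
    let K : H →L[ℂ] H := Real.exp (-1) • U μ⁻¹
    have hK : ‖K‖ < 1 := by
      refine (ContinuousLinearMap.opNorm_le_bound K (Real.exp_nonneg (-1)) fun v => ?_).trans_lt
        (by simp)
      simp [K, norm_smul, hU.norm_map]
    refine ⟨Ring.inverse (1 - K) x, ?_⟩
    have := Ring.mul_inverse_cancel _ (isUnit_one_sub_of_norm_lt_one hK)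
    simpa [K] using DFunLike.congr_fun this x
  let F : ℝ → H := fun s => Real.exp (-μ * s) • U s y
  have hF : Continuous F := by
    have := hc y
    fun_prop
  have hint : ∀ a b, IntervalIntegrable F MeasureTheory.volume a b := hF.intervalIntegrable
  -- A translation of the variable moves `U h` into the bounds, so differentiating in `h` needs no
  -- regularity of `y`.
  have hU' : ∀ h, U h (∫ t in (0 : ℝ)..μ⁻¹, F t) =
      Real.exp (μ * h) • ((∫ s in (0 : ℝ)..(h + μ⁻¹), F s) - ∫ s in (0 : ℝ)..h, F s) := by
    intro h
    rw [intervalIntegral.integral_interval_sub_left (hint _ _) (hint _ _),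
      ← (U h).intervalIntegral_comp_comm (hint _ _), ← intervalIntegral.integral_smul]
    have := intervalIntegral.integral_comp_add_left
      (fun s => Real.exp (μ * h) • F s) (a := 0) (b := μ⁻¹) h
    rw [add_zero] at this
    rw [← this]
    refine intervalIntegral.integral_congr fun t _ => ?_
    simp only [F, ContinuousLinearMap.map_smul_of_tower, ← hU.add_apply, smul_smul, ← Real.exp_add]
    congr 2
    ring
  have hd : ∀ b, HasDerivAt (fun h => ∫ s in (0 : ℝ)..h, F s) (F b) b := fun b =>
    intervalIntegral.integral_hasDerivAt_right (hint _ _)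
      hF.stronglyMeasurable.stronglyMeasurableAtFilter hF.continuousAt
  have hd1 : HasDerivAt (fun h => ∫ s in (0 : ℝ)..(h + μ⁻¹), F s) (F μ⁻¹) 0 :=
    HasDerivAt.comp_add_const 0 μ⁻¹ (by simpa using hd μ⁻¹)
  have hd2 : HasDerivAt (fun h : ℝ => Real.exp (μ * h)) μ 0 := by
    simpa using ((hasDerivAt_id (0 : ℝ)).const_mul μ).exp
  have hd3 := hd2.fun_smul (hd1.fun_sub (hd 0))
  refine ⟨∫ t in (0 : ℝ)..μ⁻¹, F t, _, by simpa only [hU'] using hd3, ?_⟩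
  simp [F, hμ, hU.zero_apply, ← hy]

/-- A strongly continuous one parameter unitary group of `H`. -/
structure IsStrongUnitaryGroup (U : ℝ → H →L[ℂ] H) : Prop extends IsUnitaryGroup U where
  continuous_apply : ∀ ψ, Continuous fun t => U t ψ

namespace IsStrongUnitaryGroup

variable {ħ : ℝ} {U : ℝ → H →L[ℂ] H} (hU : IsStrongUnitaryGroup U)
include hU

theorem hasDerivAt_apply (hħ : 0 < ħ) (ψ : (hamiltonian ħ U).domain) (t : ℝ) :
    HasDerivAt (fun s => U s (ψ : H)) (U t ((Complex.I * ħ)⁻¹ • hamiltonian ħ U ψ)) t := by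
  have hne : Complex.I * (ħ : ℂ) ≠ 0 := by simp [hħ.ne']
  exact hU.hasDerivAt ((hamiltonian_apply_eq_iff_hasDerivAt hħ).1
    ⟨ψ.2, by rw [smul_inv_smul₀ hne]⟩) t

theorem hasDerivAt_neg_apply (hħ : 0 < ħ) (ψ : (hamiltonian ħ U).domain) (t : ℝ) :
    HasDerivAt (fun s => U (-s) (ψ : H)) (-U (-t) ((Complex.I * ħ)⁻¹ • hamiltonian ħ U ψ)) t := by
  simpa [Function.comp_def] using (hU.hasDerivAt_apply hħ ψ (-t)).scomp t (hasDerivAt_neg t)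

/-- Differentiate the constant function `⟨U t φ, U t ψ⟩` at 0. -/
theorem isFormalAdjoint (hħ : 0 < ħ) :
    (hamiltonian ħ U).IsFormalAdjoint (hamiltonian ħ U) := by
  intro φ ψ
  have hne : (ħ : ℂ) ≠ 0 := by simp [hħ.ne']
  have h := (hU.hasDerivAt_apply hħ φ 0).inner ℂ (hU.hasDerivAt_apply hħ ψ 0)
  simp only [hU.inner_map_map] at h
  have h0 := h.unique (hasDerivAt_const _ _)
  simp only [inner_smul_left, inner_smul_right, map_inv₀, map_mul, Complex.conj_I,
    Complex.conj_ofReal] at h0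
  field_simp at h0
  linear_combination -h0

theorem exists_apply_sub_smul_eq (hħ : 0 < ħ) {μ : ℝ} (hμ : μ ≠ 0) (x : H) :
    ∃ u : (hamiltonian ħ U).domain, hamiltonian ħ U u - (Complex.I * μ) • (u : H) = x := by
  have hne : Complex.I * (ħ : ℂ) ≠ 0 := by simp [hħ.ne']
  -- Dividing `A u - iμu = x` by `-iħ`, with `A u = iħ g`, gives `(μ/ħ)u - g = -(iħ)⁻¹x`.
  obtain ⟨u, g, hg, hx⟩ := hU.exists_smul_sub_deriv_eq hU.continuous_apply
    (div_ne_zero hμ hħ.ne') (-(Complex.I * (ħ : ℂ))⁻¹ • x)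
  obtain ⟨h, hA⟩ := (hamiltonian_apply_eq_iff_hasDerivAt hħ).2 hg
  refine ⟨⟨u, h⟩, ?_⟩
  have hgx : g = (μ / ħ) • u + (Complex.I * (ħ : ℂ))⁻¹ • x := by
    rw [← sub_eq_iff_eq_add', ← neg_sub, hx, neg_smul, neg_neg]
  have hμħ : (ħ : ℂ) ≠ 0 := by simp [hħ.ne']
  rw [hA, hgx, smul_add, smul_inv_smul₀ hne, ← Complex.coe_smul, smul_smul]
  have : Complex.I * (ħ : ℂ) * ((μ / ħ : ℝ) : ℂ) = Complex.I * μ := by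
    push_cast; field_simp
  rw [this, add_sub_cancel_left]

theorem isSelfAdjoint_hamiltonian (hħ : 0 < ħ) : IsSelfAdjoint (hamiltonian ħ U) :=
  (hU.isFormalAdjoint hħ).isSelfAdjoint (z := Complex.I * (1 : ℝ))
    (hU.exists_apply_sub_smul_eq hħ one_ne_zero)
    (by simpa using hU.exists_apply_sub_smul_eq hħ (neg_ne_zero.2 one_ne_zero))

theorem hamiltonian_comm (hħ : 0 < ħ) (t : ℝ) (ψ : (hamiltonian ħ U).domain) :
    ∃ h : U t ψ ∈ (hamiltonian ħ U).domain,
      hamiltonian ħ U ⟨U t ψ, h⟩ = U t (hamiltonian ħ U ψ) := by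
  have hne : Complex.I * (ħ : ℂ) ≠ 0 := by simp [hħ.ne']
  have h := HasDerivAt.comp_add_const 0 t (f := fun s => U s (ψ : H))
    (by rw [zero_add]; exact hU.hasDerivAt_apply hħ ψ t)
  simp only [hU.add_apply] at h
  obtain ⟨h1, h2⟩ := (hamiltonian_apply_eq_iff_hasDerivAt hħ).2 h
  refine ⟨h1, h2.trans ?_⟩
  rw [map_smul, smul_inv_smul₀ hne]

theorem schrodingerEquation (hħ : 0 < ħ) {ψ : H} (hψ : ψ ∈ (hamiltonian ħ U).domain) :
    SchrodingerEquation ħ (hamiltonian ħ U) fun t => U t ψ := by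
  have hne : Complex.I * (ħ : ℂ) ≠ 0 := by simp [hħ.ne']
  intro t
  obtain ⟨h, hA⟩ := hU.hamiltonian_comm hħ t ⟨ψ, hψ⟩
  refine ⟨h, _, hU.hasDerivAt_apply hħ ⟨ψ, hψ⟩ t, ?_⟩
  rw [map_smul, smul_inv_smul₀ hne]
  exact hA.symm

theorem weakSchrodingerEquation (hħ : 0 < ħ) (ψ : H) :
    WeakSchrodingerEquation ħ (hamiltonian ħ U) fun t => U t ψ := by
  have hne : (ħ : ℂ) ≠ 0 := by simp [hħ.ne']
  intro φ t
  -- Moving the group onto `φ` leaves `ψ` arbitrary.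
  have h := (hU.hasDerivAt_neg_apply hħ φ t).inner ℂ (hasDerivAt_const t ψ)
  simp only [hU.inner_map_left, neg_neg, map_zero, inner_zero_right, zero_add, inner_neg_left] at h
  refine ⟨_, h, ?_⟩
  rw [inner_smul_left]
  simp only [map_inv₀, map_mul, Complex.conj_I, Complex.conj_ofReal]
  have hI := Complex.I_ne_zero
  field_simp

theorem heisenbergEquation (hħ : 0 < ħ) (Y : H →L[ℂ] H) :
    HeisenbergEquation ħ (hamiltonian ħ U) (evolvedObservable U Y) := by
  have hne : Complex.I * (ħ : ℂ) ≠ 0 := by simp [hħ.ne']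
  intro t ψ h
  have hf : HasDerivAt (fun s => Y (U (-s) (ψ : H))) _ t :=
    (Y.restrictScalars ℝ).hasFDerivAt.comp_hasDerivAt t (hU.hasDerivAt_neg_apply hħ ψ t)
  -- `Y U(-t) ψ = U(-t) Y(t) ψ` is in the domain because the group preserves it.
  obtain ⟨h', hA⟩ := hU.hamiltonian_comm hħ (-t) ⟨_, h⟩
  simp only [hU.evolvedObservable_apply, hU.neg_apply_apply] at h' hA
  have hg := hU.hasDerivAt_apply hħ ⟨_, h'⟩ t
  have hd := HasDerivAt.contraction_apply (fun s x => (hU.norm_map s x).le)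
    (fun x => (hU.continuous_apply x).continuousAt) hf hg
  simp only [hU.evolvedObservable_apply]
  refine ⟨_, hd, ?_⟩
  simp only [hA, map_smul, map_neg, hU.apply_neg_apply, ContinuousLinearMap.coe_restrictScalars',
    smul_add, smul_neg, smul_inv_smul₀ hne]
  abel

theorem weakHeisenbergEquation (hħ : 0 < ħ) (Y : H →L[ℂ] H) :
    WeakHeisenbergEquation ħ (hamiltonian ħ U) (evolvedObservable U Y) := by
  have hne : (ħ : ℂ) ≠ 0 := by simp [hħ.ne']
  intro φ ψ t
  have hY : HasDerivAt (fun s => Y (U (-s) (ψ : H))) _ t :=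
    (Y.restrictScalars ℝ).hasFDerivAt.comp_hasDerivAt t (hU.hasDerivAt_neg_apply hħ ψ t)
  have h := (hU.hasDerivAt_neg_apply hħ φ t).inner ℂ hY
  simp only [hU.inner_map_left, neg_neg] at h
  simp only [hU.evolvedObservable_apply]
  refine ⟨_, h, ?_⟩
  simp only [ContinuousLinearMap.coe_restrictScalars', map_smul, map_neg, inner_smul_left,
    inner_smul_right, inner_neg_left, inner_neg_right, hU.inner_map_left, neg_neg, map_inv₀,
    map_mul, Complex.conj_I, Complex.conj_ofReal]
  have hI := Complex.I_ne_zero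
  field_simp
  ring

/-- Duhamel's estimate of the difference between `U(t)` and the exponential of a bounded operator
which commutes with `U`. -/
theorem norm_sub_exp_apply_le (hħ : 0 < ħ) {C : H →L[ℂ] H}
    (hC : ∀ s : ℝ, NormedSpace.exp (s • C) ∈ unitary (H →L[ℂ] H))
    (hCU : ∀ s x, C (U s x) = U s (C x)) (ψ : (hamiltonian ħ U).domain) (t : ℝ) :
    ‖U t (ψ : H) - NormedSpace.exp (t • C) (ψ : H)‖ ≤
      ‖(Complex.I * ħ)⁻¹ • hamiltonian ħ U ψ - C ψ‖ * |t| := by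
  have hn : ∀ (s : ℝ) x, ‖NormedSpace.exp (s • C) x‖ = ‖x‖ := fun s =>
    ContinuousLinearMap.norm_map_of_mem_unitary (hC s)
  have hexp : ∀ s x, HasDerivAt (fun s : ℝ => NormedSpace.exp ((t - s) • C) x)
      (-NormedSpace.exp ((t - s) • C) (C x)) s := fun s x => by
    have h1 := (hasDerivAt_exp_smul_const C (t - s)).scomp s ((hasDerivAt_id s).const_sub t)
    have h2 := ((ContinuousLinearMap.apply ℂ H x).restrictScalars ℝ).hasFDerivAt.comp_hasDerivAt
      s h1
    simpa [Function.comp_def] using h2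
  -- This path joins `exp (tC) ψ` to `U t ψ`; its speed has constant norm, since both factors are
  -- isometric.
  have hd : ∀ s, HasDerivAt (fun s => NormedSpace.exp ((t - s) • C) (U s (ψ : H)))
      (NormedSpace.exp ((t - s) • C) (U s ((Complex.I * ħ)⁻¹ • hamiltonian ħ U ψ - C ψ))) s :=
    fun s => by
      have := HasDerivAt.contraction_apply (V := fun s => NormedSpace.exp ((t - s) • C))
        (fun s x => (hn (t - s) x).le) (fun x => (hexp s x).continuousAt)
        (hU.hasDerivAt_apply hħ ψ s) (hexp s (U s (ψ : H)))
      rw [hCU] at this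
      rwa [map_sub, map_sub, sub_eq_add_neg]
  have := convex_univ.norm_image_sub_le_of_norm_hasDerivWithin_le (x := 0) (y := t)
    (fun s _ => (hd s).hasDerivWithinAt) (fun s _ => (by rw [hn, hU.norm_map])) trivial trivial
  simpa [hU.zero_apply] using this

theorem isOperatorExp (hħ : 0 < ħ) (t : ℝ) :
    IsOperatorExp (t / (Complex.I * ħ)) (hamiltonian ħ U) (U t) := by
  have hA := hU.isFormalAdjoint hħ
  have hd := (hU.isSelfAdjoint_hamiltonian hħ).dense_domain
  have hex : ∀ n : ℕ, ∃ B, IsBoundedApprox (hamiltonian ħ U) (n + 1) B := fun n =>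
    exists_isBoundedApprox hA (fun μ hμ => hU.exists_apply_sub_smul_eq hħ hμ) (by positivity)
  choose B hB using hex
  have hsmul : ∀ (s : ℝ) n, s • ((Complex.I * (ħ : ℂ))⁻¹ • B n) =
      ((s : ℂ) / (Complex.I * ħ)) • B n := fun s n => by
    rw [← Complex.coe_smul, smul_smul, div_eq_mul_inv]
  have hunit : ∀ n (s : ℝ), NormedSpace.exp (s • ((Complex.I * (ħ : ℂ))⁻¹ • B n)) ∈
      unitary (H →L[ℂ] H) := fun n s => by
    rw [hsmul]
    refine exp_mem_unitary_of_isSelfAdjoint ((hB n).isSelfAdjoint hA) ?_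
    simp [div_neg]
  refine ⟨B, hB, fun ψ => ?_⟩
  simp only [← hsmul]
  refine tendsto_apply_of_dense
    (T := fun n => NormedSpace.exp (t • ((Complex.I * (ħ : ℂ))⁻¹ • B n)))
    (fun n x => (ContinuousLinearMap.norm_map_of_mem_unitary (hunit n t) x).le)
    (fun x => (hU.norm_map t x).le) hd (fun φ hφ => ?_) ψ
  have hlim := IsBoundedApprox.tendsto_apply hA hd hB ⟨φ, hφ⟩
  rw [tendsto_iff_norm_sub_tendsto_zero]
  refine squeeze_zero (fun _ => norm_nonneg _) (fun n => ?_)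
    (g := fun n => ‖(Complex.I * (ħ : ℂ))⁻¹ • hamiltonian ħ U ⟨φ, hφ⟩ -
      (Complex.I * (ħ : ℂ))⁻¹ • B n φ‖ * |t|) ?_
  · rw [norm_sub_rev]
    exact hU.norm_sub_exp_apply_le hħ (hunit n)
      (fun s x => by simp [(hB n).apply_comm (hU.hamiltonian_comm hħ s)]) ⟨φ, hφ⟩ t
  · simpa using (((hlim.const_smul (Complex.I * (ħ : ℂ))⁻¹).const_sub
      ((Complex.I * (ħ : ℂ))⁻¹ • hamiltonian ħ U ⟨φ, hφ⟩)).norm).mul_const |t|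

end IsStrongUnitaryGroup

end Stone

/-! ### Continuity of all orbits, and the conclusion -/

/-- The vectors of `E` with continuous orbit form a subspace containing all initial values, hence
all of `E`; density of the chart does the rest. -/
theorem GalileanModel.continuous_apply {M E H : Type*} [NormedAddCommGroup E] [NormedSpace ℂ E]
    [NormedAddCommGroup H] [InnerProductSpace ℂ H] [CompleteSpace H] {d : ℕ} [NeZero d]
    (S : GalileanModel M E H d) {U : ℝ → H →L[ℂ] H} (hU : IsUnitaryGroup U)
    (h : ∀ m, Continuous fun t => U t (S.chart (S.X 0 m))) (ψ : H) :
    Continuous fun t => U t ψ := by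
  let p : Submodule ℂ E :=
    { carrier := {x | Continuous fun t => U t (S.chart x)}
      add_mem' := fun {x y} hx hy => by simpa using Continuous.fun_add hx hy
      zero_mem' := by simpa using continuous_const
      smul_mem' := fun c x hx => by simpa using Continuous.fun_const_smul hx c }
  have hp : p = ⊤ := S.eq_top_of_forall_X_mem p h
  refine hU.continuous_of_dense S.chart_denseRange ?_ ψ
  rintro _ ⟨x, rfl⟩
  exact hp.ge (Submodule.mem_top (x := x))

theorem proposition20 (ħ : ℝ) (hħ : 0 < ħ) {M E H : Type*}
    [NormedAddCommGroup E] [NormedSpace ℂ E] [CompleteSpace E]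
    [NormedAddCommGroup H] [InnerProductSpace ℂ H] [CompleteSpace H]
    {d : ℕ} [NeZero d] (S : GalileanModel M E H d) :
    ∃ Ud U : ℝ → H →L[ℂ] H, IsUnitaryGroup Ud ∧ IsUnitaryGroup U ∧
      -- the operators represent the laws of conversion between observers
      (∀ t v, Ud t (S.chartD v) = S.chartD (S.convD t v)) ∧
      (∀ t x, U t (S.chart x) = S.chart (S.conv t x)) ∧
      -- the evolution of the system
      (∀ m t, (S.evolution m t).1 = Ud t (S.evolution m 0).1 ∧
        (S.evolution m t).2 = U t (S.evolution m 0).2) ∧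
      -- the operators of the observables, as seen by the observers
      (∀ (y : EuclideanSpace ℂ (Fin d) → EuclideanSpace ℂ (Fin d)) (Y : H →L[ℂ] H),
        (∀ v, Y (S.chartD v) = S.chartD (y v)) →
          ∀ t v, evolvedObservable Ud Y t (S.chartD (S.convD t v)) = S.chartD (S.convD t (y v))) ∧
      (∀ (y : E → E) (Y : H →L[ℂ] H), (∀ x, Y (S.chart x) = S.chart (y x)) →
        ∀ t x, evolvedObservable U Y t (S.chart (S.conv t x)) = S.chart (S.conv t (y x))) ∧
      -- the continuous variables
      ((∀ m, Continuous fun t => (S.evolution m t).2) →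
        ∃ A : H →ₗ.[ℂ] H, IsSelfAdjoint A ∧ IsGenerator ħ A U ∧
          (∀ t : ℝ, IsOperatorExp (t / (Complex.I * ħ)) A (U t)) ∧
          -- `A` commutes with `U`
          (∀ (t : ℝ) (ψ : A.domain), ∃ h : U t ψ ∈ A.domain, A ⟨U t ψ, h⟩ = U t (A ψ)) ∧
          -- the Schrödinger equation
          (∀ ψ₀ ∈ A.domain, SchrodingerEquation ħ A (fun t => U t ψ₀)) ∧
          (∀ m, (S.evolution m 0).2 ∈ A.domain →
            SchrodingerEquation ħ A (fun t => (S.evolution m t).2)) ∧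
          (∀ m, WeakSchrodingerEquation ħ A (fun t => (S.evolution m t).2)) ∧
          -- the Heisenberg equation
          (∀ Y : H →L[ℂ] H, HeisenbergEquation ħ A (evolvedObservable U Y) ∧
            WeakHeisenbergEquation ħ A (evolvedObservable U Y))) := by
  obtain ⟨Ud, hUd, hUdc⟩ := S.exists_unitaryGroup_discrete
  obtain ⟨U, hU, hUc⟩ := S.exists_unitaryGroup_continuous
  have hD : ∀ m t, S.chartD (S.D t m) = Ud t (S.chartD (S.D 0 m)) := fun m t => by
    rw [hUdc, ← S.D_add, zero_add]
  have hX : ∀ m t, S.chart (S.X t m) = U t (S.chart (S.X 0 m)) := fun m t => by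
    rw [hUc, ← S.X_add, zero_add]
  refine ⟨Ud, U, hUd, hU, hUdc, hUc, fun m t => ⟨hD m t, hX m t⟩, fun y Y hY t v => ?_,
    fun y Y hY t x => ?_, fun hcont => ?_⟩
  · rw [← hUdc, hUd.evolvedObservable_apply_apply, hY, hUdc]
  · rw [← hUc, hU.evolvedObservable_apply_apply, hY, hUc]
  · have hev : ∀ m, (fun t => (S.evolution m t).2) = fun t => U t (S.chart (S.X 0 m)) :=
      fun m => funext (hX m)
    simp only [hev] at hcont ⊢
    have hs : IsStrongUnitaryGroup U := ⟨hU, S.continuous_apply hU hcont⟩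
    exact ⟨hamiltonian ħ U, hs.isSelfAdjoint_hamiltonian hħ, isGenerator_hamiltonian ħ U,
      hs.isOperatorExp hħ, hs.hamiltonian_comm hħ, fun ψ hψ => hs.schrodingerEquation hħ hψ,
      fun m hm => hs.schrodingerEquation hħ hm, fun m => hs.weakSchrodingerEquation hħ _,
      fun Y => ⟨hs.heisenbergEquation hħ Y, hs.weakHeisenbergEquation hħ Y⟩⟩
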